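/- Let $R$ be an integral domain with quotient field $K$. A finitely generated ideal $J$ of $R$ is a GV-ideal if the natural map $R\to \mathrm{Hom}_R(J,R)$, $r\mapsto (j\mapsto rj)$, is an isomorphism. An $R$-module $M$ is GV-torsion if every $x\in M$ satisfies $Jx=0$ for some GV-ideal $J$. For an $R$-submodule $M\subseteq K$ let $M_w=\{x\in K : Jx\subseteq M \text{ for some GV-ideal } J\}$. An ideal $I$ of $R$ is a $w$-ideal if $I_w=I$, and $w\text{-}\mathrm{Max}(R)$ is the set of ideals that are maximal among the proper $w$-ideals of $R$ (these are prime). $R$ is a P$v$MD (Prüfer $v$-multiplication domain) if every nonzero finitely generated ideal $I$ of $R$ is $w$-invertible, i.e. $(II^{-1})_w=R$, where $I^{-1}=\{x\in K : xI\subseteq R\}$. For $R$-subalgebras $A,B\subseteq K$ let $\mu_{A,B}\colon A\otimes_R B\to K$, $a\otimes b\mapsto ab$. The following are equivalent: (0) $R$ is a P$v$MD. (1) For all $R$-subalgebras $A,B\subseteq K$, the kernel of $\mu_{A,B}$ is GV-torsion. (1') For all $R$-subalgebras $A,B\subseteq K$ and all $\mathfrak m\in w\text{-}\mathrm{Max}(R)$,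 the localized map $(\mu_{A,B})_{\mathfrak m}$ is injective. (2) For all torsion-free $R$-modules $M,N$ and all $\mathfrak m\in w\text{-}\mathrm{Max}(R)$, the localization $(M\otimes_R N)_{\mathfrak m}$ is torsion-free over $R_{\mathfrak m}$. (2') For all torsion-free $R$-modules $M,N$ and all $\mathfrak m\in w\text{-}\mathrm{Max}(R)$, the module $M_{\mathfrak m}\otimes_{R_{\mathfrak m}}N_{\mathfrak m}$ is torsion-free over $R_{\mathfrak m}$. Moreover, if these conditions hold, then $R_{\mathfrak m}$ is a valuation domain for every $\mathfrak m\in w\text{-}\mathrm{Max}(R)$. -/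

import Mathlib

open scoped TensorProduct nonZeroDivisors

section GV

variable (R : Type*) [CommRing R]

/-- `J` is a GV-ideal: it is finitely generated and the natural map
`R → Hom_R(J, R)`, `r ↦ (j ↦ r * j)`, is bijective (hence an isomorphism). -/
def IsGVIdeal (J : Ideal R) : Prop :=
  J.FG ∧ Function.Bijective (fun r : R => (r • J.subtype : J →ₗ[R] R))

/-- The subset `tor_GV(M)` of the elements of `M` that are killed by some GV-ideal. -/
def gvTorsion (M : Type*) [AddCommGroup M] [Module R M] : Set M :=
  {x | ∃ J : Ideal R, IsGVIdeal R J ∧ ∀ j ∈ J, j • x = 0}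

/-- A module is GV-torsion if it equals its GV-torsion part. -/
def IsGVTorsion (M : Type*) [AddCommGroup M] [Module R M] : Prop :=
  gvTorsion R M = Set.univ

end GV

section WOperation

variable (R : Type*) [CommRing R] (K : Type*) [Field K] [Algebra R K]

/-- The `w`-envelope `M_w = {x ∈ E(M) | J x ⊆ M for some GV-ideal J}` of an `R`-submodule `M` of
the quotient field `K` of a domain `R`. For `M ≠ 0` the injective envelope `E(M)` is `K`; for
`M = 0` the set below is `{0}`, as it should be, because `K` is torsion-free over `R`. -/
def wEnvelope (M : Submodule R K) : Set K :=
  {x | ∃ J : Ideal R, IsGVIdeal R J ∧ ∀ j ∈ J, j • x ∈ M}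

/-- An ideal `I` of `R` is a `w`-ideal if `I_w = I` inside `K`. -/
def IsWIdeal (I : Ideal R) : Prop :=
  wEnvelope R K (IsLocalization.coeSubmodule K I) = (IsLocalization.coeSubmodule K I : Set K)

/-- `w-Max(R)`: the ideals that are maximal among the proper `w`-ideals of `R`. -/
def wMax : Set (Ideal R) :=
  {m | Maximal (fun I : Ideal R => I ≠ ⊤ ∧ IsWIdeal R K I) m}

/-- `R` is a Prüfer `v`-multiplication domain: every nonzero finitely generated ideal `I` is
`w`-invertible, that is, `(I I⁻¹)_w = R`, where `I⁻¹ = {x ∈ K | x I ⊆ R}`. -/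
def IsPvMD [IsDomain R] [IsFractionRing R K] : Prop :=
  ∀ I : Ideal R, I ≠ ⊥ → I.FG →
    wEnvelope R K (((I : FractionalIdeal R⁰ K) * (I : FractionalIdeal R⁰ K)⁻¹ :
      FractionalIdeal R⁰ K) : Submodule R K) = ((1 : Submodule R K) : Set K)

variable {R K}

/-- If `J` is a GV-ideal, then `J x ⊆ R` forces `x ∈ R`. -/
theorem IsGVIdeal.exists_algebraMap_eq [IsDomain R] [IsFractionRing R K] {J : Ideal R}
    (hJ : IsGVIdeal R J) {x : K} (hx : ∀ j ∈ J, ∃ r : R, algebraMap R K r = j • x) :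
    ∃ r : R, algebraMap R K r = x := by
  have hinj : Function.Injective (algebraMap R K) := IsFractionRing.injective R K
  choose f hf using fun j : J => hx j.1 j.2
  let g : J →ₗ[R] R :=
    { toFun := f
      map_add' := fun a b => hinj (by rw [map_add, hf, hf, hf, ← add_smul]; rfl)
      map_smul' := fun a b => hinj (by
        rw [RingHom.id_apply, smul_eq_mul, map_mul, hf, hf, ← Algebra.smul_def, smul_smul]; rfl) }
  obtain ⟨r, hr⟩ := hJ.2.2 g
  have hr' : ∀ j : J, algebraMap R K (r * j.1) = j.1 • x := fun j => by
    rw [← hf j]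
    exact congrArg (algebraMap R K) (LinearMap.congr_fun hr j)
  have hne : ∃ j ∈ J, j ≠ 0 := by
    by_contra! h
    refine one_ne_zero (hJ.2.1 (a₁ := (1 : R)) (a₂ := 0) (LinearMap.ext fun j => ?_))
    simp [h j.1 j.2]
  obtain ⟨j, hj, hj0⟩ := hne
  refine ⟨r, ?_⟩
  have h := hr' ⟨j, hj⟩
  rw [map_mul, Algebra.smul_def, mul_comm] at h
  exact mul_left_cancel₀ (fun h0 => hj0 (hinj (by rw [h0, map_zero]))) h

/-- The `w`-ideals of a domain can be tested on elements of `R`. -/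
theorem isWIdeal_iff [IsDomain R] [IsFractionRing R K] {I : Ideal R} :
    IsWIdeal R K I ↔ ∀ J : Ideal R, IsGVIdeal R J → ∀ x : R, (∀ j ∈ J, j * x ∈ I) → x ∈ I := by
  have hinj : Function.Injective (algebraMap R K) := IsFractionRing.injective R K
  constructor
  · intro h J hJ x hx
    have hmem : algebraMap R K x ∈ wEnvelope R K (IsLocalization.coeSubmodule K I) :=
      ⟨J, hJ, fun j hj => (IsLocalization.mem_coeSubmodule K I).2
        ⟨j * x, hx j hj, by rw [map_mul, Algebra.smul_def]⟩⟩
    rw [h] at hmem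
    obtain ⟨y, hy, hyx⟩ := (IsLocalization.mem_coeSubmodule K I).1 hmem
    exact hinj hyx ▸ hy
  · intro h
    ext x
    constructor
    · rintro ⟨J, hJ, hx⟩
      have hx' := fun j hj => (IsLocalization.mem_coeSubmodule K I).1 (hx j hj)
      obtain ⟨r, rfl⟩ := hJ.exists_algebraMap_eq (x := x)
        fun j hj => (hx' j hj).imp fun _ hy => hy.2
      refine (IsLocalization.mem_coeSubmodule K I).2 ⟨r, h J hJ r fun j hj => ?_, rfl⟩
      obtain ⟨y, hy, hyx⟩ := hx' j hj
      rw [Algebra.smul_def, ← map_mul] at hyx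
      exact hinj hyx ▸ hy
    · intro hx
      refine ⟨⊤, ⟨⟨{1}, by simp⟩, fun a b hab => ?_, fun g => ?_⟩,
        fun j _ => Submodule.smul_mem _ j hx⟩
      · simpa using LinearMap.congr_fun hab ⟨1, trivial⟩
      · refine ⟨g ⟨1, trivial⟩, LinearMap.ext fun j => ?_⟩
        have : j = j.1 • (⟨1, trivial⟩ : (⊤ : Ideal R)) := Subtype.ext (by simp)
        rw [this, map_smul]
        simp [mul_comm]

/-- The maximal `w`-ideals are prime, so one can localize at them. -/
instance wMax.isPrime [IsDomain R] [IsFractionRing R K] (m : wMax R K) :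
    (m : Ideal R).IsPrime := by
  obtain ⟨m, hm'⟩ := m
  have hm : Maximal (fun I : Ideal R => I ≠ ⊤ ∧ IsWIdeal R K I) m := hm'
  refine ⟨hm.prop.1, fun {a b} hab => ?_⟩
  by_cases ha : a ∈ m
  · exact Or.inl ha
  refine Or.inr ?_
  let I : Ideal R := Submodule.comap (LinearMap.mulRight R a) m
  have hmemI : ∀ x, x ∈ I ↔ x * a ∈ m := fun x => Iff.rfl
  have hI : I ≠ ⊤ ∧ IsWIdeal R K I := by
    refine ⟨fun h => ha ?_, isWIdeal_iff.2 fun J hJ x hx => ?_⟩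
    · simpa using (hmemI 1).1 (h ▸ trivial)
    · exact (isWIdeal_iff.1 hm.prop.2) J hJ (x * a) fun j hj => by
        simpa [mul_assoc] using (hmemI _).1 (hx j hj)
  exact hm.le_of_ge hI (fun x hx => (hmemI x).2 (m.mul_mem_right a hx))
    ((hmemI b).2 (by rwa [mul_comm]))

end WOperation

universe u v w

/-!
Everything is reduced to the single condition that `R_m` is a valuation domain for each maximal
`w`-ideal `m`.

The reduction rests on a local-global principle, `exists_isGVIdeal_le_iff`: an ideal contains a
GV-ideal exactly when it lies in no maximal `w`-ideal. So a module is GV-torsion exactly when it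
vanishes at all maximal `w`-ideals (`isGVTorsion_iff_forall_wMax`), and a nonzero finitely generated
ideal `I` is `w`-invertible exactly when `I I⁻¹ ∩ R` lies in no maximal `w`-ideal, that is, when `I`
is locally principal there (`isPvMD_iff_forall_valuationRing`).

If `R_m` is a valuation domain, torsion-free modules are flat over it, and so their tensor products
are torsion-free. The kernel of `A ⊗ B → K` consists of torsion elements, hence vanishes at `m`.

Conversely, suppose that tensor products of torsion-free modules are torsion-free at `m`. For
`I = (a, b)` the element `a ⊗ b - b ⊗ a` of `I ⊗ I` is torsion; if neither of `a`, `b` divided the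
other in `R_m`, functionals `I → R / m` dual to `a`, `b` would show that it is nonzero at `m`
(`exists_dvd_of_smul_tmul_sub_tmul`). If instead the kernels of the maps `A ⊗ B → K` vanish at `m`,
then all overrings `A` of `O = R_m` are epimorphic extensions of `O`. Finite ones are then trivial,
so `O` is integrally closed. For `x ∈ K` the ring `O[x]` cannot map onto the polynomial ring over
the residue field, so `x` is a root of a polynomial over `O` with a unit coefficient, and
Seidenberg's lemma gives `x ∈ O` or `x⁻¹ ∈ O` (`valuationRing_of_forall_isEpi`).
-/

/-! ### GV-ideals and the maximal `w`-ideals -/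

section GVIdeals

variable {R : Type*} [CommRing R] [IsDomain R]

theorem IsGVIdeal.ne_bot {J : Ideal R} (hJ : IsGVIdeal R J) : J ≠ ⊥ := by
  rintro rfl
  refine one_ne_zero (hJ.2.1 (a₁ := (1 : R)) (a₂ := 0) (LinearMap.ext fun j => ?_))
  have : (j : R) = 0 := (Submodule.mem_bot R).1 j.2
  simp [this]

/-- A converse to `IsGVIdeal.exists_algebraMap_eq`: a nonzero finitely generated ideal with
`J⁻¹ = R` is a GV-ideal, since every `R`-linear map `J → R` is multiplication by an element of
the quotient field. -/
theorem isGVIdeal_of_fg (K : Type*) [Field K] [Algebra R K] [IsFractionRing R K]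
    {J : Ideal R} (hfg : J.FG) (hJ : J ≠ ⊥)
    (h : ∀ x : K, (∀ j ∈ J, ∃ r : R, algebraMap R K r = j • x) → ∃ r : R, algebraMap R K r = x) :
    IsGVIdeal R J := by
  have hinj : Function.Injective (algebraMap R K) := IsFractionRing.injective R K
  obtain ⟨j₀, hj₀, hne⟩ := Submodule.exists_mem_ne_zero_of_ne_bot hJ
  have hne' : algebraMap R K j₀ ≠ 0 := fun h0 => hne (hinj (by rw [h0, map_zero]))
  refine ⟨hfg, fun a b hab => ?_, fun g => ?_⟩
  · have := LinearMap.congr_fun hab ⟨j₀, hj₀⟩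
    exact mul_right_cancel₀ hne (by simpa using this)
  · -- `g` is multiplication by `g j₀ / j₀`
    have key : ∀ j : J, algebraMap R K (g j) =
        j.1 • (algebraMap R K (g ⟨j₀, hj₀⟩) / algebraMap R K j₀) := by
      intro j
      have h1 : j₀ • j = j.1 • (⟨j₀, hj₀⟩ : J) := Subtype.ext (mul_comm _ _)
      have h2 := congrArg (fun y => algebraMap R K (g y)) h1
      simp only [map_smul, smul_eq_mul, map_mul] at h2
      rw [Algebra.smul_def, mul_div_assoc', eq_div_iff hne', ← h2, mul_comm]
    obtain ⟨r, hr⟩ := h _ fun j hj => ⟨g ⟨j, hj⟩, key ⟨j, hj⟩⟩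
    refine ⟨r, LinearMap.ext fun j => hinj ?_⟩
    rw [key j, ← hr, Algebra.smul_def]
    simp [mul_comm]

theorem IsGVIdeal.mul {I J : Ideal R} (hI : IsGVIdeal R I) (hJ : IsGVIdeal R J) :
    IsGVIdeal R (I * J) := by
  refine isGVIdeal_of_fg (FractionRing R) (hI.1.mul hJ.1) (mul_ne_zero hI.ne_bot hJ.ne_bot)
    fun x hx => hI.exists_algebraMap_eq fun i hi => hJ.exists_algebraMap_eq fun j hj => ?_
  obtain ⟨r, hr⟩ := hx (i * j) (Ideal.mul_mem_mul hi hj)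
  exact ⟨r, by rw [hr, mul_comm, mul_smul]⟩

theorem isGVIdeal_top : IsGVIdeal R (⊤ : Ideal R) :=
  isGVIdeal_of_fg (FractionRing R) ⟨{1}, by simp⟩ top_ne_bot fun x hx => by
    simpa using hx 1 trivial

variable (R) in
/-- The `w`-closure of an ideal `I`, as an ideal of `R`: the elements that some GV-ideal
multiplies into `I`. -/
def wClosure (I : Ideal R) : Ideal R where
  carrier := {x | ∃ J : Ideal R, IsGVIdeal R J ∧ ∀ j ∈ J, j * x ∈ I}
  zero_mem' := ⟨⊤, isGVIdeal_top, by simp⟩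
  add_mem' := by
    rintro x y ⟨J, hJ, hx⟩ ⟨J', hJ', hy⟩
    refine ⟨J * J', hJ.mul hJ', fun j hj => ?_⟩
    rw [mul_add]
    exact I.add_mem (hx j (Ideal.mul_le_left hj)) (hy j (Ideal.mul_le_right hj))
  smul_mem' := by
    rintro c x ⟨J, hJ, hx⟩
    exact ⟨J, hJ, fun j hj => by
      rw [smul_eq_mul, mul_left_comm]; exact I.mul_mem_left c (hx j hj)⟩

theorem mem_wClosure {I : Ideal R} {x : R} :
    x ∈ wClosure R I ↔ ∃ J : Ideal R, IsGVIdeal R J ∧ ∀ j ∈ J, j * x ∈ I := Iff.rfl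

theorem le_wClosure (I : Ideal R) : I ≤ wClosure R I := fun _ hx =>
  ⟨⊤, isGVIdeal_top, fun j _ => I.mul_mem_left j hx⟩

/-- A finitely generated ideal inside the `w`-closure of `I` is multiplied into `I` by a single
GV-ideal. -/
theorem exists_isGVIdeal_mul_le {I L : Ideal R} (hL : L.FG) (h : L ≤ wClosure R I) :
    ∃ J : Ideal R, IsGVIdeal R J ∧ J * L ≤ I := by
  induction L, hL using Submodule.fg_induction with
  | singleton x =>
    obtain ⟨J, hJ, hx⟩ := h (Submodule.mem_span_singleton_self x)
    refine ⟨J, hJ, Ideal.mul_le.2 fun j hj y hy => ?_⟩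
    obtain ⟨c, rfl⟩ := Submodule.mem_span_singleton.1 hy
    rw [smul_eq_mul, mul_left_comm]
    exact I.mul_mem_left c (hx j hj)
  | sup L₁ L₂ _ _ h₁ h₂ =>
    obtain ⟨J₁, hJ₁, hle₁⟩ := h₁ (le_sup_left.trans h)
    obtain ⟨J₂, hJ₂, hle₂⟩ := h₂ (le_sup_right.trans h)
    refine ⟨J₁ * J₂, hJ₁.mul hJ₂, ?_⟩
    rw [Ideal.mul_sup]
    exact sup_le ((Ideal.mul_mono_left Ideal.mul_le_left).trans hle₁)
      ((Ideal.mul_mono_left Ideal.mul_le_right).trans hle₂)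

variable (K : Type*) [Field K] [Algebra R K] [IsFractionRing R K]

theorem isWIdeal_wClosure (I : Ideal R) : IsWIdeal R K (wClosure R I) := by
  refine isWIdeal_iff.2 fun J hJ x hx => ?_
  obtain ⟨J', hJ', hle⟩ := exists_isGVIdeal_mul_le (I := I) (L := J * Ideal.span {x})
    (hJ.1.mul ⟨{x}, by simp⟩) (Ideal.mul_le.2 fun j hj y hy => by
      obtain ⟨c, rfl⟩ := Ideal.mem_span_singleton'.1 hy
      rw [mul_left_comm]
      exact Ideal.mul_mem_left _ c (hx j hj))
  refine ⟨J' * J, hJ'.mul hJ, fun j hj => hle ?_⟩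
  rw [← mul_assoc]
  exact Ideal.mul_mem_mul hj (Ideal.mem_span_singleton_self x)

/-- Zorn's lemma applies to proper `w`-ideals because GV-ideals are finitely generated. -/
theorem exists_le_wMax {I : Ideal R} (hI : I ≠ ⊤) (hw : IsWIdeal R K I) :
    ∃ m : wMax R K, I ≤ m := by
  suffices hub : ∀ c ⊆ {I : Ideal R | I ≠ ⊤ ∧ IsWIdeal R K I}, IsChain (· ≤ ·) c → ∀ L ∈ c,
      ∃ ub ∈ {I : Ideal R | I ≠ ⊤ ∧ IsWIdeal R K I}, ∀ z ∈ c, z ≤ ub by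
    obtain ⟨m, hIm, hm⟩ := zorn_le_nonempty₀ _ hub I ⟨hI, hw⟩
    exact ⟨⟨m, hm⟩, hIm⟩
  intro c hc hchain L hL
  have hdir : DirectedOn (· ≤ ·) c := hchain.directedOn
  refine ⟨sSup c, ⟨fun h => ?_, isWIdeal_iff.2 fun J hJ x hx => ?_⟩, fun z hz => le_sSup hz⟩
  · obtain ⟨L', hL', h1⟩ := (Submodule.mem_sSup_of_directed ⟨L, hL⟩ hdir).1
      ((Ideal.eq_top_iff_one _).1 h)
    exact (hc hL').1 ((Ideal.eq_top_iff_one _).2 h1)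
  · have hfg : (J * Ideal.span {x}).FG := hJ.1.mul ⟨{x}, by simp⟩
    obtain ⟨L', hL', hle⟩ := (CompleteLattice.isCompactElement_iff_le_of_directed_sSup_le _ _).1
      ((Submodule.fg_iff_compact _).1 hfg) c ⟨L, hL⟩ hdir (Ideal.mul_le.2 fun j hj y hy => by
        obtain ⟨d, rfl⟩ := Ideal.mem_span_singleton'.1 hy
        rw [mul_left_comm]
        exact Ideal.mul_mem_left _ d (hx j hj))
    exact le_sSup hL' (isWIdeal_iff.1 (hc hL').2 J hJ x fun j hj =>
      hle (Ideal.mul_mem_mul hj (Ideal.mem_span_singleton_self x)))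

/-- An ideal contains a GV-ideal exactly when it lies in no maximal `w`-ideal. This is the
local-global principle behind all reductions to the localizations at maximal `w`-ideals. -/
theorem exists_isGVIdeal_le_iff {I : Ideal R} :
    (∃ J : Ideal R, IsGVIdeal R J ∧ J ≤ I) ↔ ∀ m : wMax R K, ¬ I ≤ m := by
  constructor
  · rintro ⟨J, hJ, hle⟩ m hm
    have hmax : Maximal (fun I : Ideal R => I ≠ ⊤ ∧ IsWIdeal R K I) m := m.2
    refine hmax.prop.1 ((Ideal.eq_top_iff_one _).2 ?_)
    exact isWIdeal_iff.1 hmax.prop.2 J hJ 1 fun j hj => by simpa using hm (hle hj)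
  · intro h
    have htop : wClosure R I = ⊤ := by
      by_contra hne
      obtain ⟨m, hm⟩ := exists_le_wMax K hne (isWIdeal_wClosure K I)
      exact h m ((le_wClosure I).trans hm)
    obtain ⟨J, hJ, h1⟩ := mem_wClosure.1 ((Ideal.eq_top_iff_one _).1 htop)
    exact ⟨J, hJ, fun j hj => by simpa using h1 j hj⟩

theorem isGVTorsion_iff_forall_wMax {M : Type*} [AddCommGroup M] [Module R M] :
    IsGVTorsion R M ↔ ∀ (x : M) (m : wMax R K), ∃ s ∉ (m : Ideal R), s • x = 0 := by
  rw [IsGVTorsion, Set.eq_univ_iff_forall]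
  refine forall_congr' fun x => ?_
  have h := exists_isGVIdeal_le_iff K (I := LinearMap.ker (LinearMap.toSpanSingleton R M x))
  simp only [SetLike.not_le_iff_exists] at h
  simp only [SetLike.le_def, LinearMap.mem_ker,
    LinearMap.toSpanSingleton_apply] at h
  simpa [gvTorsion, and_comm] using h

end GVIdeals

/-! ### PvMDs as locally valuation domains -/

/-- If `R_m` is a valuation domain, finitely generated ideals become
principal at `m`, generated by one of their elements. -/
theorem exists_forall_dvd_mul_of_fg {R : Type*} [CommRing R] {m : Ideal R} [m.IsPrime]
    (hm : ∀ a b : R, ∃ s ∉ m, a ∣ s * b ∨ b ∣ s * a) {I : Ideal R} (hI : I.FG) :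
    ∃ a ∈ I, ∃ s ∉ m, ∀ y ∈ I, a ∣ s * y := by
  induction I, hI using Submodule.fg_induction with
  | singleton x =>
    refine ⟨x, Submodule.mem_span_singleton_self x, 1, m.one_notMem, fun y hy => ?_⟩
    simpa using Ideal.mem_span_singleton.1 hy
  | sup I₁ I₂ _ _ h₁ h₂ =>
    obtain ⟨a, ha, s, hs, has⟩ := h₁
    obtain ⟨b, hb, t, ht, hbt⟩ := h₂
    have hmul : ∀ {x y}, x ∉ m → y ∉ m → x * y ∉ m := fun hx hy => m.primeCompl.mul_mem hx hy
    obtain ⟨u, hu, ⟨c, hc⟩ | ⟨c, hc⟩⟩ := hm a b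
    · refine ⟨a, le_sup_left (a := I₁) ha, u * s * t, hmul (hmul hu hs) ht, fun y hy => ?_⟩
      obtain ⟨y₁, hy₁, y₂, hy₂, rfl⟩ := Submodule.mem_sup.1 hy
      obtain ⟨d, hd⟩ := has y₁ hy₁
      obtain ⟨e, he⟩ := hbt y₂ hy₂
      exact ⟨u * t * d + s * c * e, by linear_combination u * t * hd + u * s * he + s * e * hc⟩
    · refine ⟨b, le_sup_right (a := I₁) hb, u * s * t, hmul (hmul hu hs) ht, fun y hy => ?_⟩
      obtain ⟨y₁, hy₁, y₂, hy₂, rfl⟩ := Submodule.mem_sup.1 hy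
      obtain ⟨d, hd⟩ := has y₁ hy₁
      obtain ⟨e, he⟩ := hbt y₂ hy₂
      exact ⟨t * c * d + u * s * e, by linear_combination u * t * hd + u * s * he + t * d * hc⟩

section PvMD

variable {R : Type*} [CommRing R] [IsDomain R]

/-- `R_m` is a valuation domain if and only if of any two elements of `R`, one divides the other
up to a factor outside `m`. -/
theorem valuationRing_localization_iff (m : Ideal R) [m.IsPrime] :
    ValuationRing (Localization.AtPrime m) ↔
      ∀ a b : R, ∃ s ∉ m, a ∣ s * b ∨ b ∣ s * a := by
  have hinj : Function.Injective (algebraMap R (Localization.AtPrime m)) :=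
    IsLocalization.injective _ m.primeCompl_le_nonZeroDivisors
  have hdvd : ∀ a b : R, algebraMap R (Localization.AtPrime m) a ∣ algebraMap R _ b ↔
      ∃ s ∉ m, a ∣ s * b := by
    intro a b
    constructor
    · rintro ⟨c, hc⟩
      obtain ⟨⟨r, s⟩, hrs⟩ := IsLocalization.surj m.primeCompl c
      refine ⟨s, s.2, r, hinj ?_⟩
      rw [map_mul, map_mul, hc, ← hrs]
      ring
    · rintro ⟨s, hs, c, hc⟩
      have hu : IsUnit (algebraMap R (Localization.AtPrime m) s) :=
        IsLocalization.map_units _ (⟨s, hs⟩ : m.primeCompl)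
      rw [← hu.dvd_mul_left, ← map_mul, hc, map_mul]
      exact dvd_mul_right _ _
  rw [ValuationRing.iff_dvd_total]
  constructor
  · rintro ⟨h⟩ a b
    rcases h (algebraMap R _ a) (algebraMap R _ b) with h | h
    · obtain ⟨s, hs, h⟩ := (hdvd a b).1 h
      exact ⟨s, hs, Or.inl h⟩
    · obtain ⟨s, hs, h⟩ := (hdvd b a).1 h
      exact ⟨s, hs, Or.inr h⟩
  · intro h
    refine ⟨fun x y => ?_⟩
    obtain ⟨⟨a, s⟩, ha⟩ := IsLocalization.surj m.primeCompl x
    obtain ⟨⟨b, t⟩, hb⟩ := IsLocalization.surj m.primeCompl y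
    have hs : IsUnit (algebraMap R (Localization.AtPrime m) s) := IsLocalization.map_units _ s
    have ht : IsUnit (algebraMap R (Localization.AtPrime m) t) := IsLocalization.map_units _ t
    have hxy : x ∣ y ↔ algebraMap R (Localization.AtPrime m) a ∣ algebraMap R _ b := by
      rw [← ha, ← hb, hs.mul_right_dvd, ht.dvd_mul_right]
    have hyx : y ∣ x ↔ algebraMap R (Localization.AtPrime m) b ∣ algebraMap R _ a := by
      rw [← ha, ← hb, ht.mul_right_dvd, hs.dvd_mul_right]
    rw [hxy, hyx, hdvd, hdvd]
    obtain ⟨u, hu, h | h⟩ := h a b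
    · exact Or.inl ⟨u, hu, h⟩
    · exact Or.inr ⟨u, hu, h⟩

variable (K : Type*) [Field K] [Algebra R K] [IsFractionRing R K]

/-- `I` is `w`-invertible if and only if `I I⁻¹ ∩ R` lies in no maximal `w`-ideal. -/
theorem wEnvelope_mul_inv_eq_one_iff {I : Ideal R} (hI : I ≠ ⊥) :
    wEnvelope R K (((I : FractionalIdeal R⁰ K) * (I : FractionalIdeal R⁰ K)⁻¹ :
      FractionalIdeal R⁰ K) : Submodule R K) = ((1 : Submodule R K) : Set K) ↔
    ∀ m : wMax R K, ∃ t ∉ (m : Ideal R), algebraMap R K t ∈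
      ((I : FractionalIdeal R⁰ K) * (I : FractionalIdeal R⁰ K)⁻¹ : FractionalIdeal R⁰ K) := by
  have hI' : (I : FractionalIdeal R⁰ K) ≠ 0 := FractionalIdeal.coeIdeal_ne_zero.2 hI
  set p : FractionalIdeal R⁰ K := (I : FractionalIdeal R⁰ K) * (I : FractionalIdeal R⁰ K)⁻¹ with hp
  have hp1 : p ≤ 1 := FractionalIdeal.mul_le.2 fun y hy x hx => by
    rw [mul_comm]
    exact (FractionalIdeal.mem_inv_iff hI').1 hx y hy
  have h := exists_isGVIdeal_le_iff K (I := (p : Submodule R K).comap (Algebra.linearMap R K))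
  simp only [SetLike.not_le_iff_exists] at h
  simp only [SetLike.le_def, Submodule.mem_comap,
    Algebra.linearMap_apply, FractionalIdeal.mem_coe] at h
  have hR : (∃ J : Ideal R, IsGVIdeal R J ∧ ∀ ⦃x : R⦄, x ∈ J → algebraMap R K x ∈ p) ↔
      ∀ m : wMax R K, ∃ t ∉ (m : Ideal R), algebraMap R K t ∈ p := by
    rw [h]
    simp only [and_comm]
  rw [← hR]
  constructor
  · intro he
    have h1 : (1 : K) ∈ wEnvelope R K (p : Submodule R K) := by
      rw [he]; exact Submodule.one_le.1 le_rfl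
    obtain ⟨J, hJ, h1⟩ := h1
    exact ⟨J, hJ, fun j hj => by simpa [Algebra.smul_def] using h1 j hj⟩
  · rintro ⟨J, hJ, hJp⟩
    ext x
    constructor
    · rintro ⟨J', hJ', hx⟩
      obtain ⟨r, rfl⟩ := hJ'.exists_algebraMap_eq (x := x) fun j hj =>
        (FractionalIdeal.mem_one_iff R⁰).1 (hp1 (hx j hj))
      exact Submodule.mem_one.2 ⟨r, rfl⟩
    · intro hx
      obtain ⟨r, rfl⟩ := Submodule.mem_one.1 hx
      refine ⟨J, hJ, fun j hj => ?_⟩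
      rw [Algebra.smul_def, mul_comm, ← Algebra.smul_def]
      exact Submodule.smul_mem _ r (hJp hj)

theorem isPvMD_iff_forall_valuationRing :
    IsPvMD R K ↔ ∀ m : wMax R K, ValuationRing (Localization.AtPrime (m : Ideal R)) := by
  have hinj : Function.Injective (algebraMap R K) := IsFractionRing.injective R K
  simp only [valuationRing_localization_iff]
  constructor
  · intro h m a b
    rcases eq_or_ne a 0 with rfl | ha
    · exact ⟨1, m.1.one_notMem, Or.inr (by simp)⟩
    have hI : Ideal.span {a, b} ≠ ⊥ := fun h0 =>
      ha (by simpa using (h0 ▸ Ideal.subset_span (by simp) : a ∈ (⊥ : Ideal R)))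
    obtain ⟨t, htm, ht⟩ := (wEnvelope_mul_inv_eq_one_iff K hI).1
      (h _ hI (Submodule.fg_span (Set.toFinite _))) m
    by_contra! hno
    -- if neither divides the other at `m`, then `I I⁻¹ ⊆ m`
    suffices hle : ∀ z ∈ ((Ideal.span {a, b} : Ideal R) : FractionalIdeal R⁰ K) *
        ((Ideal.span {a, b} : Ideal R) : FractionalIdeal R⁰ K)⁻¹,
        ∃ c ∈ (m : Ideal R), algebraMap R K c = z by
      obtain ⟨c, hc, hct⟩ := hle _ ht
      exact htm (hinj hct ▸ hc)
    intro z hz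
    refine FractionalIdeal.mul_induction_on hz (fun y hy x hx => ?_) ?_
    · rw [FractionalIdeal.mem_inv_iff (FractionalIdeal.coeIdeal_ne_zero.2 hI)] at hx
      obtain ⟨α, hα⟩ := (FractionalIdeal.mem_one_iff R⁰).1 (hx (algebraMap R K a)
        (FractionalIdeal.mem_coeIdeal_of_mem _ (Ideal.subset_span (by simp))))
      obtain ⟨β, hβ⟩ := (FractionalIdeal.mem_one_iff R⁰).1 (hx (algebraMap R K b)
        (FractionalIdeal.mem_coeIdeal_of_mem _ (Ideal.subset_span (by simp))))
      have hab : α * b = β * a := hinj (by rw [map_mul, map_mul, hα, hβ]; ring)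
      have hαm : α ∈ (m : Ideal R) := by
        by_contra hn
        exact (hno α hn).1 ⟨β, by rw [hab, mul_comm]⟩
      have hβm : β ∈ (m : Ideal R) := by
        by_contra hn
        exact (hno β hn).2 ⟨α, by rw [← hab, mul_comm]⟩
      obtain ⟨y', hy', rfl⟩ := (FractionalIdeal.mem_coeIdeal _).1 hy
      obtain ⟨c, d, rfl⟩ := Ideal.mem_span_pair.1 hy'
      refine ⟨c * α + d * β, Ideal.add_mem _ (Ideal.mul_mem_left _ c hαm)
        (Ideal.mul_mem_left _ d hβm), ?_⟩
      simp only [map_add, map_mul, hα, hβ]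
      ring
    · rintro _ _ ⟨c, hc, rfl⟩ ⟨d, hd, rfl⟩
      exact ⟨c + d, Ideal.add_mem _ hc hd, map_add _ _ _⟩
  · intro h I hI hfg
    refine (wEnvelope_mul_inv_eq_one_iff K hI).2 fun m => ?_
    obtain ⟨a, ha, s, hs, has⟩ := exists_forall_dvd_mul_of_fg (h m) hfg
    have ha0 : a ≠ 0 := by
      rintro rfl
      obtain ⟨y, hy, hy0⟩ := Submodule.exists_mem_ne_zero_of_ne_bot hI
      rcases mul_eq_zero.1 (zero_dvd_iff.1 (has y hy)) with rfl | h0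
      · exact hs (Ideal.zero_mem _)
      · exact hy0 h0
    have ha0' : algebraMap R K a ≠ 0 := fun h0 => ha0 (hinj (by rw [h0, map_zero]))
    refine ⟨s, hs, ?_⟩
    -- `s = a * (s / a)` with `s / a ∈ I⁻¹`
    have hs' : algebraMap R K s = algebraMap R K a * (algebraMap R K s / algebraMap R K a) := by
      field_simp
    rw [hs']
    refine FractionalIdeal.mul_mem_mul (FractionalIdeal.mem_coeIdeal_of_mem _ ha)
      ((FractionalIdeal.mem_inv_iff (FractionalIdeal.coeIdeal_ne_zero.2 hI)).2 fun y hy => ?_)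
    obtain ⟨z, hz, rfl⟩ := (FractionalIdeal.mem_coeIdeal _).1 hy
    obtain ⟨c, hc⟩ := has z hz
    refine (FractionalIdeal.mem_one_iff R⁰).2 ⟨c, ?_⟩
    rw [div_mul_eq_mul_div, eq_div_iff ha0', ← map_mul, ← map_mul, hc, mul_comm]

end PvMD

/-! ### Domains all of whose overrings are epimorphic extensions -/

section Epimorphic

open Polynomial

/-- If `x` is a root only of polynomials with reduction zero, then `O[x]` has the polynomial ring
over the residue field as a quotient, and `O[x]` is not epimorphic over `O` because of the two
maps `x ↦ X` and `x ↦ X + 1`. -/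
theorem exists_aeval_eq_zero_map_residue_ne_zero {O : Type*} [CommRing O]
    [IsLocalRing O] {K : Type*} [Field K] [Algebra O K] (x : K)
    (hx : Algebra.IsEpi O (aeval (R := O) x).range) :
    ∃ p : O[X], p.map (IsLocalRing.residue O) ≠ 0 ∧ aeval x p = 0 := by
  by_contra! hno
  let k := IsLocalRing.ResidueField O
  let f : O[X] →ₐ[O] (aeval (R := O) x).range := (aeval (R := O) x).rangeRestrict
  have hf : Function.Surjective f := AlgHom.rangeRestrict_surjective _
  let φ : O[X] →ₐ[O] k[X] := mapAlgHom (Algebra.ofId O k)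
  let σ : k[X] →ₐ[O] k[X] := (aeval (X + 1 : k[X])).restrictScalars O
  have hker : ∀ p : O[X], f p = 0 → φ p = 0 := by
    intro p hp
    have h0 : aeval x p = 0 := congrArg Subtype.val hp
    by_contra hne
    exact hno p hne h0
  let e := Ideal.quotientKerAlgEquivOfSurjective hf
  let g₁ : (aeval (R := O) x).range →ₐ[O] k[X] :=
    (Ideal.Quotient.liftₐ (RingHom.ker f) φ fun p hp => hker p hp).comp e.symm.toAlgHom
  have hg₁ : g₁ (f X) = X := by
    have : e.symm (f X) = Ideal.Quotient.mk _ X := by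
      rw [AlgEquiv.symm_apply_eq]; rfl
    simp [g₁, this, φ]
  have h := congrArg (Algebra.TensorProduct.productMap g₁ (σ.comp g₁))
    ((Algebra.isEpi_iff_forall_one_tmul_eq O _).1 hx (f X))
  simp [hg₁, σ] at h

variable {O : Type*} [CommRing O] [IsLocalRing O]
  {K : Type*} [Field K] [Algebra O K] [IsFractionRing O K]

/-- Seidenberg's `u, u⁻¹`-lemma: over an integrally closed local domain, a root of a polynomial
with a unit coefficient lies in the domain or has its inverse there. -/
theorem isInteger_or_isInteger_inv_of_aeval_eq_zero
    (hint : ∀ y : K, IsIntegral O y → IsLocalization.IsInteger O y) {x : K} (p : O[X])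
    (hp : p.map (IsLocalRing.residue O) ≠ 0) (hx : aeval x p = 0) :
    IsLocalization.IsInteger O x ∨ IsLocalization.IsInteger O x⁻¹ := by
  have hinj : Function.Injective (algebraMap O K) := IsFractionRing.injective O K
  induction hn : p.natDegree using Nat.strong_induction_on generalizing p with | h d ih
  obtain _ | n := d
  · obtain ⟨c, rfl⟩ := natDegree_eq_zero.1 hn
    rw [aeval_C] at hx
    simp [(map_eq_zero_iff _ hinj).1 hx] at hp
  · set a := p.leadingCoeff with ha
    have ha0 : a ≠ 0 := by
      rw [ha, Ne, leadingCoeff_eq_zero]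
      rintro rfl
      simp at hp
    obtain ⟨b, hb⟩ := hint _ (isIntegral_leadingCoeff_smul p x hx)
    rw [← ha, Algebra.smul_def] at hb
    have ha0' : algebraMap O K a ≠ 0 := (map_ne_zero_iff _ hinj).2 ha0
    by_cases hau : IsUnit a
    · obtain ⟨c, hc⟩ := hau.exists_left_inv
      refine Or.inl ⟨c * b, ?_⟩
      rw [map_mul, hb, ← mul_assoc, ← map_mul, hc, map_one, one_mul]
    by_cases hbu : IsUnit b
    · obtain ⟨c, hc⟩ := hbu.exists_left_inv
      refine Or.inr ⟨c * a, ?_⟩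
      refine eq_inv_of_mul_eq_one_left ?_
      rw [map_mul, mul_assoc, ← hb, ← map_mul, hc, map_one]
    -- replace the leading term `a Xⁿ⁺¹` by `b Xⁿ`; as `a` and `b` lie in the maximal ideal, the
    -- reduction of the polynomial is unchanged
    have hres : ∀ c : O, ¬ IsUnit c → IsLocalRing.residue O c = 0 := fun c hc =>
      (IsLocalRing.residue_eq_zero_iff c).2 hc
    have hdecomp : p = p.eraseLead + C a * X ^ (n + 1) := by
      conv_lhs => rw [← eraseLead_add_C_mul_X_pow p, hn]
    set q := p.eraseLead + C b * X ^ n with hq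
    have hqmap : q.map (IsLocalRing.residue O) = p.map (IsLocalRing.residue O) := by
      conv_rhs => rw [hdecomp]
      simp [hq, hres a hau, hres b hbu]
    have hqx : aeval x q = 0 := by
      rw [hdecomp] at hx
      rw [← hx]
      simp only [hq, map_add, map_mul, aeval_C, map_pow, aeval_X, hb]
      ring
    have hle : q.natDegree ≤ n := by
      refine natDegree_add_le_of_degree_le ?_ (natDegree_C_mul_X_pow_le b n)
      exact (eraseLead_natDegree_le p).trans (by omega)
    exact ih _ (Nat.lt_succ_of_le hle) q (hqmap ▸ hp) hqx rfl

/-- A local domain `O` is a valuation domain if `O → A` is an epimorphism for all `O`-subalgebras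
`A` of its quotient field. Finite epimorphic extensions are trivial, so `O` is integrally closed,
and Seidenberg's lemma applies. -/
theorem valuationRing_of_forall_isEpi [IsDomain O] (h : ∀ A : Subalgebra O K, Algebra.IsEpi O A) :
    ValuationRing O := by
  have hint : ∀ y : K, IsIntegral O y → IsLocalization.IsInteger O y := by
    intro y hy
    have hfin : Module.Finite O (Algebra.adjoin O {y}) :=
      Module.Finite.iff_fg.2 hy.fg_adjoin_singleton
    obtain ⟨r, hr⟩ := Algebra.isEpi_iff_surjective_algebraMap_of_finite.1
      (h (Algebra.adjoin O {y})) ⟨y, Algebra.self_mem_adjoin_singleton O y⟩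
    exact ⟨r, congrArg Subtype.val hr⟩
  refine (ValuationRing.iff_isInteger_or_isInteger O K).2 fun x => ?_
  obtain ⟨p, hp, hpx⟩ := exists_aeval_eq_zero_map_residue_ne_zero x (h _)
  exact isInteger_or_isInteger_inv_of_aeval_eq_zero hint p hp hpx

end Epimorphic

/-! ### Tensor products of overrings -/

section Overrings

variable {R : Type*} [CommRing R] [IsDomain R] {K : Type*} [Field K] [Algebra R K]
  [IsFractionRing R K]

/-- If the kernels of all `A ⊗ B → K` vanish at `m`, then `R_m` is a valuation domain. It is enough
to take for `A = B` the subalgebras that contain `R_m`. -/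
theorem valuationRing_localization_of_mulMap {m : Ideal R} [m.IsPrime]
    (h : ∀ A B : Subalgebra R K, ∀ z : A ⊗[R] B, A.mulMap B z = 0 → ∃ s ∉ m, s • z = 0) :
    ValuationRing (Localization.AtPrime m) := by
  let O := Localization.AtPrime m
  have hu : ∀ s : m.primeCompl, IsUnit (algebraMap R K s) := fun s =>
    ((map_ne_zero_iff _ (IsFractionRing.injective R K)).2
      (nonZeroDivisors.ne_zero (m.primeCompl_le_nonZeroDivisors s.2))).isUnit
  let : Algebra O K := (IsLocalization.lift (S := O) hu).toAlgebra
  have : IsScalarTower R O K := .of_algebraMap_eq fun r => (IsLocalization.lift_eq hu r).symm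
  have : IsFractionRing O K :=
    IsFractionRing.isFractionRing_of_isDomain_of_isLocalization m.primeCompl O K
  refine valuationRing_of_forall_isEpi (K := K) fun A => ?_
  refine (Algebra.isEpi_iff_forall_one_tmul_eq O A).2 fun a => ?_
  -- `A ⊗[R] A` maps onto `A ⊗[O] A`, and there the elements outside `m` act invertibly
  let A' : Subalgebra R K := A.restrictScalars R
  let a' : A' := ⟨a, a.2⟩
  obtain ⟨s, hs, hz⟩ := h A' A' (1 ⊗ₜ a' - a' ⊗ₜ 1) (by simp)
  let ι : A' →ₗ[R] A :=
    { toFun := fun x => ⟨x, x.2⟩, map_add' := fun _ _ => rfl, map_smul' := fun _ _ => rfl }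
  let q : A' ⊗[R] A' →ₗ[R] A ⊗[O] A :=
    TensorProduct.mapOfCompatibleSMul O R R A A ∘ₗ TensorProduct.map ι ι
  have hq : ∀ x y : A', q (x ⊗ₜ y) = ι x ⊗ₜ[O] ι y := fun _ _ => rfl
  have hz2 : s • ((1 : A) ⊗ₜ[O] a - a ⊗ₜ[O] 1) = 0 := by
    have hz' := congrArg q hz
    rwa [map_smul, map_sub, map_zero, hq, hq] at hz'
  rw [← algebraMap_smul O s] at hz2
  rw [← sub_eq_zero]
  exact (IsLocalization.map_units O (⟨s, hs⟩ : m.primeCompl)).smul_eq_zero.1 hz2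

/-- Every element of `A ⊗ B` has a nonzero multiple in the image of `R`. -/
theorem exists_smul_eq_smul_one_tmul_one (A B : Subalgebra R K) (z : A ⊗[R] B) :
    ∃ r : R, r ≠ 0 ∧ ∃ c : R, r • z = c • ((1 : A) ⊗ₜ[R] (1 : B)) := by
  have key : ∀ (C : Subalgebra R K) (x : C), ∃ r : R, r ≠ 0 ∧ ∃ c : R, r • x = c • (1 : C) := by
    intro C x
    obtain ⟨⟨c, r⟩, h⟩ := IsLocalization.surj R⁰ (x : K)
    refine ⟨r, nonZeroDivisors.ne_zero r.2, c, Subtype.ext ?_⟩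
    simpa [Algebra.smul_def, mul_comm] using h
  induction z using TensorProduct.induction_on with
  | zero => exact ⟨1, one_ne_zero, 0, by simp⟩
  | tmul x y =>
    obtain ⟨r, hr, c, hc⟩ := key A x
    obtain ⟨s, hs, d, hd⟩ := key B y
    exact ⟨r * s, mul_ne_zero hr hs, c * d, by
      rw [← TensorProduct.smul_tmul_smul, hc, hd, TensorProduct.smul_tmul_smul]⟩
  | add x y hx hy =>
    obtain ⟨r, hr, c, hc⟩ := hx
    obtain ⟨s, hs, d, hd⟩ := hy
    refine ⟨r * s, mul_ne_zero hr hs, s * c + r * d, ?_⟩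
    rw [smul_add, mul_comm r s, mul_smul, hc, mul_comm s r, mul_smul, hd, add_smul, mul_smul,
      mul_smul]

theorem exists_smul_eq_zero_of_mulMap_eq_zero {A B : Subalgebra R K} {z : A ⊗[R] B}
    (hz : A.mulMap B z = 0) : ∃ r : R, r ≠ 0 ∧ r • z = 0 := by
  obtain ⟨r, hr, c, hc⟩ := exists_smul_eq_smul_one_tmul_one A B z
  have h := congrArg (A.mulMap B) hc
  rw [map_smul, hz, smul_zero, map_smul, Subalgebra.mulMap_tmul] at h
  have hc0 : c = 0 := by
    rw [Algebra.smul_def] at h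
    simpa using h.symm
  exact ⟨r, hr, by rw [hc, hc0, zero_smul]⟩

/-- The kernel of a localized map vanishes if and only if each element of the kernel is killed by a
denominator. -/
theorem localizedModule_map_injective_iff {R M N : Type*} [CommRing R] [AddCommGroup M]
    [Module R M] [AddCommGroup N] [Module R N] {S : Submonoid R} {f : M →ₗ[R] N}
    (hN : ∀ s ∈ S, ∀ y : N, s • y = 0 → y = 0) :
    Function.Injective (LocalizedModule.map S f) ↔
      ∀ z, f z = 0 → ∃ s ∈ S, s • z = 0 := by
  rw [injective_iff_map_eq_zero]
  constructor
  · intro h z hz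
    have := h (LocalizedModule.mk z 1) (by rw [LocalizedModule.map_mk, hz, LocalizedModule.zero_mk])
    exact (IsLocalizedModule.mem_ker_iff S (g := LocalizedModule.mkLinearMap S M)).1 this
  · intro h x hx
    induction x using LocalizedModule.induction_on with
    | h z t =>
      rw [LocalizedModule.map_mk, ← LocalizedModule.zero_mk t, LocalizedModule.mk_eq] at hx
      obtain ⟨u, hu⟩ := hx
      simp only [smul_zero] at hu
      obtain ⟨s, hs, hsz⟩ := h z (hN t t.2 _ (hN u u.2 _ hu))
      rw [← LocalizedModule.zero_mk t, LocalizedModule.mk_eq]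
      exact ⟨⟨s, hs⟩, by
        simp only [smul_zero, Submonoid.smul_def]; rw [smul_comm, hsz, smul_zero]⟩

theorem localizedModule_map_mulMap_injective_iff (m : Ideal R) [m.IsPrime]
    (A B : Subalgebra R K) :
    Function.Injective (LocalizedModule.map m.primeCompl (A.mulMap B).toLinearMap) ↔
      ∀ z : A ⊗[R] B, A.mulMap B z = 0 → ∃ s ∉ m, s • z = 0 := by
  refine localizedModule_map_injective_iff fun s hs y hy => ?_
  have hs0 : algebraMap R K s ≠ 0 := (map_ne_zero_iff _ (IsFractionRing.injective R K)).2
    (nonZeroDivisors.ne_zero (m.primeCompl_le_nonZeroDivisors hs))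
  rw [Algebra.smul_def] at hy
  exact (mul_eq_zero.1 hy).resolve_left hs0

theorem isGVTorsion_ker_mulMap_iff (A B : Subalgebra R K) :
    IsGVTorsion R (LinearMap.ker (A.mulMap B).toLinearMap) ↔
      ∀ (m : wMax R K) (z : A ⊗[R] B), A.mulMap B z = 0 → ∃ s ∉ (m : Ideal R), s • z = 0 := by
  rw [isGVTorsion_iff_forall_wMax K, forall_comm]
  refine forall_congr' fun m => ⟨fun h z hz => ?_, fun h z => ?_⟩
  · obtain ⟨s, hs, h⟩ := h ⟨z, hz⟩
    exact ⟨s, hs, congrArg Subtype.val h⟩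
  · obtain ⟨s, hs, h⟩ := h z.1 z.2
    exact ⟨s, hs, Subtype.ext h⟩

end Overrings

/-! ### Tensor products of torsion-free modules -/

section TorsionFree

/-- Over a valuation domain torsion-free modules are flat, so that tensor products of torsion-free
modules are torsion-free. -/
theorem ValuationRing.isTorsionFree_tensorProduct {O M N : Type*} [CommRing O] [IsDomain O]
    [ValuationRing O] [AddCommGroup M] [Module O M] [AddCommGroup N] [Module O N]
    [Module.IsTorsionFree O M] [Module.IsTorsionFree O N] :
    Module.IsTorsionFree O (M ⊗[O] N) := by
  have : Module.Flat O M := Module.Flat.flat_iff_torsion_eq_bot_of_isBezout.2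
    (Submodule.isTorsionFree_iff_torsion_eq_bot.1 inferInstance)
  have : Module.Flat O N := Module.Flat.flat_iff_torsion_eq_bot_of_isBezout.2
    (Submodule.isTorsionFree_iff_torsion_eq_bot.1 inferInstance)
  infer_instance

variable {R : Type*} [CommRing R]

/-- Localization commutes with tensor products; the equivalence is obtained by writing localization
as base change to `S⁻¹ R`. -/
noncomputable def localizedModuleTensorEquiv (S : Submonoid R) (M N : Type*) [AddCommGroup M]
    [Module R M] [AddCommGroup N] [Module R N] :
    LocalizedModule S (M ⊗[R] N) ≃ₗ[Localization S]
      LocalizedModule S M ⊗[Localization S] LocalizedModule S N :=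
  LocalizedModule.equivTensorProduct S (M ⊗[R] N) ≪≫ₗ
    TensorProduct.AlgebraTensorModule.distribBaseChange R (Localization S) M N ≪≫ₗ
    TensorProduct.congr (LocalizedModule.equivTensorProduct S M).symm
      (LocalizedModule.equivTensorProduct S N).symm

theorem isTorsionFree_localizedModule_tensorProduct_iff (S : Submonoid R) (M N : Type*)
    [AddCommGroup M] [Module R M] [AddCommGroup N] [Module R N] :
    Module.IsTorsionFree (Localization S) (LocalizedModule S (M ⊗[R] N)) ↔
      Module.IsTorsionFree (Localization S)
        (LocalizedModule S M ⊗[Localization S] LocalizedModule S N) := by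
  let e := localizedModuleTensorEquiv S M N
  exact ⟨fun _ => e.symm.injective.moduleIsTorsionFree _ fun r x => map_smul e.symm r x,
    fun _ => e.injective.moduleIsTorsionFree _ fun r x => map_smul e r x⟩

theorem isTorsionFree_tensorProduct_localizedModule [IsDomain R] {m : Ideal R} [m.IsPrime]
    (hm : ValuationRing (Localization.AtPrime m)) (M N : Type*) [AddCommGroup M] [Module R M]
    [AddCommGroup N] [Module R N] [Module.IsTorsionFree R M] [Module.IsTorsionFree R N] :
    Module.IsTorsionFree (Localization.AtPrime m)
      (LocalizedModule m.primeCompl M ⊗[Localization.AtPrime m]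
        LocalizedModule m.primeCompl N) :=
  have : Module.IsTorsionFree (Localization.AtPrime m) (LocalizedModule m.primeCompl M) :=
    IsLocalizedModule.isTorsionFree (LocalizedModule.mkLinearMap m.primeCompl M) m.primeCompl
  have : Module.IsTorsionFree (Localization.AtPrime m) (LocalizedModule m.primeCompl N) :=
    IsLocalizedModule.isTorsionFree (LocalizedModule.mkLinearMap m.primeCompl N) m.primeCompl
  ValuationRing.isTorsionFree_tensorProduct

theorem exists_notMem_smul_eq_zero [IsDomain R] {m : Ideal R} [m.IsPrime] {T : Type*}
    [AddCommGroup T] [Module R T]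
    (hT : Module.IsTorsionFree (Localization.AtPrime m) (LocalizedModule m.primeCompl T))
    {r : R} (hr : r ≠ 0) {t : T} (ht : r • t = 0) : ∃ s ∉ m, s • t = 0 := by
  have hr' : algebraMap R (Localization.AtPrime m) r ≠ 0 :=
    (map_ne_zero_iff _ (IsLocalization.injective _ m.primeCompl_le_nonZeroDivisors)).2 hr
  have h : algebraMap R (Localization.AtPrime m) r •
      LocalizedModule.mkLinearMap m.primeCompl T t = 0 := by
    rw [algebraMap_smul, ← map_smul, ht, map_zero]
  exact (IsLocalizedModule.mem_ker_iff m.primeCompl).1 ((smul_eq_zero.1 h).resolve_left hr')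

/-- If all relations between `a` and `b` have their first coefficient in `m`, then there is a
linear map `(a, b) → R / m` with `a ↦ 1` and `b ↦ 0`. -/
theorem exists_linearMap_span_pair {m I : Ideal R} {a b : R} (hI : I = Ideal.span {a, b})
    (ha : a ∈ I) (hb : b ∈ I) (h : ∀ x y : R, x * a + y * b = 0 → x ∈ m) :
    ∃ φ : I →ₗ[R] R ⧸ m, φ ⟨a, ha⟩ = 1 ∧ φ ⟨b, hb⟩ = 0 := by
  let f : R × R →ₗ[R] I :=
    (LinearMap.toSpanSingleton R I ⟨a, ha⟩).coprod (LinearMap.toSpanSingleton R I ⟨b, hb⟩)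
  let g : R × R →ₗ[R] R ⧸ m := m.mkQ ∘ₗ LinearMap.fst R R R
  have hf : Function.Surjective f := by
    rintro ⟨z, hz⟩
    obtain ⟨x, y, rfl⟩ := Ideal.mem_span_pair.1 (hI ▸ hz)
    exact ⟨(x, y), Subtype.ext (by simp [f])⟩
  have hfg : LinearMap.ker f ≤ LinearMap.ker g := by
    rintro ⟨x, y⟩ hxy
    have h0 : x * a + y * b = 0 := by simpa [f] using congrArg Subtype.val hxy
    simpa [g, Ideal.Quotient.eq_zero_iff_mem] using h x y h0
  let φ : I →ₗ[R] R ⧸ m :=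
    (LinearMap.ker f).liftQ g hfg ∘ₗ (f.quotKerEquivOfSurjective hf).symm.toLinearMap
  have hφ : ∀ p, φ (f p) = g p := by
    intro p
    have : (f.quotKerEquivOfSurjective hf).symm (f p) = Submodule.Quotient.mk p := by
      rw [LinearEquiv.symm_apply_eq]; rfl
    simp [φ, this]
  refine ⟨φ, ?_, ?_⟩
  · have : f (1, 0) = ⟨a, ha⟩ := by simp [f]
    rw [← this, hφ]; rfl
  · have : f (0, 1) = ⟨b, hb⟩ := by simp [f]
    rw [← this, hφ]; simp [g]

/-- If `a` and `b` are incomparable at `m`, then no `s ∉ m` kills `a ⊗ b - b ⊗ a` in `I ⊗ I` for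
`I = (a, b)`, although `a` does. -/
theorem exists_dvd_of_smul_tmul_sub_tmul {m I : Ideal R} [m.IsPrime] {a b : R}
    (hI : I = Ideal.span {a, b}) (ha : a ∈ I) (hb : b ∈ I) {t : R} (ht : t ∉ m)
    (h : t • ((⟨a, ha⟩ : I) ⊗ₜ[R] (⟨b, hb⟩ : I) - (⟨b, hb⟩ : I) ⊗ₜ[R] (⟨a, ha⟩ : I)) = 0) :
    ∃ s ∉ m, a ∣ s * b ∨ b ∣ s * a := by
  by_contra! hno
  obtain ⟨φ, hφa, hφb⟩ := exists_linearMap_span_pair (m := m) hI ha hb fun x y hxy => by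
    by_contra hx
    exact (hno x hx).2 ⟨-y, by linear_combination hxy⟩
  obtain ⟨ψ, hψb, hψa⟩ := exists_linearMap_span_pair (m := m)
    (hI.trans (by rw [Set.pair_comm])) hb ha fun x y hxy => by
      by_contra hx
      exact (hno x hx).1 ⟨-y, by linear_combination hxy⟩
  have h' := congrArg (LinearMap.mul' R (R ⧸ m) ∘ₗ TensorProduct.map φ ψ) h
  simp only [map_smul, map_sub, LinearMap.comp_apply, TensorProduct.map_tmul, hφa, hφb, hψa, hψb,
    map_zero, LinearMap.mul'_apply, mul_one, mul_zero, sub_zero] at h'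
  rw [Algebra.smul_def, mul_one] at h'
  exact ht (Ideal.Quotient.eq_zero_iff_mem.1 h')

/-- If tensor products of torsion-free modules are torsion-free at `m`, then `R_m` is a valuation
domain. Only the squares `I ⊗ I` of ideals with two generators are used; they are lifted to the
universe of the hypothesis. -/
theorem valuationRing_localization_of_isTorsionFree_tensorProduct {R : Type u} [CommRing R]
    [IsDomain R] {m : Ideal R} [m.IsPrime]
    (h : ∀ (M N : Type (max u w)) [AddCommGroup M] [Module R M] [AddCommGroup N] [Module R N],
        Module.IsTorsionFree R M → Module.IsTorsionFree R N →
        Module.IsTorsionFree (Localization.AtPrime m)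
          (LocalizedModule m.primeCompl (M ⊗[R] N))) :
    ValuationRing (Localization.AtPrime m) := by
  refine (valuationRing_localization_iff m).2 fun a b => ?_
  rcases eq_or_ne a 0 with rfl | ha0
  · exact ⟨1, m.one_notMem, Or.inr (by simp)⟩
  let I : Ideal R := Ideal.span {a, b}
  have ha : a ∈ I := Ideal.subset_span (by simp)
  have hb : b ∈ I := Ideal.subset_span (by simp)
  have hIt : Module.IsTorsionFree R (ULift.{w} I) :=
    ULift.moduleEquiv.injective.moduleIsTorsionFree
      (ULift.moduleEquiv : ULift.{w} I ≃ₗ[R] I) fun r x => rfl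
  have h1 := h (ULift.{w} I) (ULift.{w} I) hIt hIt
  let A : ULift.{w} I := ⟨⟨a, ha⟩⟩
  let B : ULift.{w} I := ⟨⟨b, hb⟩⟩
  have hab : a • B = b • A := ULift.ext _ _ (Subtype.ext (mul_comm a b))
  have hkill : a • (A ⊗ₜ[R] B - B ⊗ₜ[R] A) = 0 := by
    rw [smul_sub, ← TensorProduct.tmul_smul, hab, TensorProduct.smul_tmul', hab,
      TensorProduct.tmul_smul, TensorProduct.smul_tmul', sub_self]
  obtain ⟨t, ht, htz⟩ := exists_notMem_smul_eq_zero h1 ha0 hkill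
  refine exists_dvd_of_smul_tmul_sub_tmul (I := I) rfl ha hb ht ?_
  simpa [A, B] using congrArg (TensorProduct.map
    (ULift.moduleEquiv : ULift.{w} I ≃ₗ[R] I).toLinearMap
    (ULift.moduleEquiv : ULift.{w} I ≃ₗ[R] I).toLinearMap) htz

end TorsionFree

/-! ### The characterization of PvMDs -/

theorem corollary3p3 (R : Type u) [CommRing R] [IsDomain R]
    (K : Type v) [Field K] [Algebra R K] [IsFractionRing R K] :
    List.TFAE [
      IsPvMD R K,
      ∀ A B : Subalgebra R K, IsGVTorsion R (LinearMap.ker (A.mulMap B).toLinearMap),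
      ∀ A B : Subalgebra R K, ∀ m : wMax R K,
        Function.Injective
          (LocalizedModule.map (m : Ideal R).primeCompl (A.mulMap B).toLinearMap),
      ∀ (M N : Type (max u w)) [AddCommGroup M] [Module R M] [AddCommGroup N] [Module R N],
        Module.IsTorsionFree R M → Module.IsTorsionFree R N → ∀ m : wMax R K,
        Module.IsTorsionFree (Localization.AtPrime (m : Ideal R))
          (LocalizedModule (m : Ideal R).primeCompl (M ⊗[R] N)),
      ∀ (M N : Type (max u w)) [AddCommGroup M] [Module R M] [AddCommGroup N] [Module R N],
        Module.IsTorsionFree R M → Module.IsTorsionFree R N → ∀ m : wMax R K,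
        Module.IsTorsionFree (Localization.AtPrime (m : Ideal R))
          (LocalizedModule (m : Ideal R).primeCompl M ⊗[Localization.AtPrime (m : Ideal R)]
            LocalizedModule (m : Ideal R).primeCompl N)] ∧
    (IsPvMD R K → ∀ m : wMax R K, ValuationRing (Localization.AtPrime (m : Ideal R))) := by
  refine ⟨?_, (isPvMD_iff_forall_valuationRing K).1⟩
  rw [isPvMD_iff_forall_valuationRing K]
  tfae_have 1 → 5 := fun hV M N _ _ _ _ _ _ m =>
    isTorsionFree_tensorProduct_localizedModule (hV m) M N
  tfae_have 5 → 4 := fun h M N _ _ _ _ hM hN m =>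
    (isTorsionFree_localizedModule_tensorProduct_iff _ M N).2 (h M N hM hN m)
  tfae_have 4 → 1 := fun h m =>
    valuationRing_localization_of_isTorsionFree_tensorProduct.{u, w}
      fun M N _ _ _ _ hM hN => h M N hM hN m
  tfae_have 1 → 3 := by
    intro hV A B m
    refine (localizedModule_map_mulMap_injective_iff _ A B).2 fun z hz => ?_
    -- kernel elements are torsion, and `(A ⊗ B)_m` is torsion-free
    obtain ⟨r, hr, hrz⟩ := exists_smul_eq_zero_of_mulMap_eq_zero hz
    have hfree : ∀ C : Subalgebra R K, Module.IsTorsionFree R C := fun C =>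
      Subtype.val_injective.moduleIsTorsionFree ((↑) : C → K) fun _ _ => rfl
    have := hfree A
    have := hfree B
    exact exists_notMem_smul_eq_zero
      ((isTorsionFree_localizedModule_tensorProduct_iff _ A B).2
        (isTorsionFree_tensorProduct_localizedModule (hV m) A B)) hr hrz
  tfae_have 3 → 2 := fun h A B => (isGVTorsion_ker_mulMap_iff A B).2 fun m =>
    (localizedModule_map_mulMap_injective_iff _ A B).1 (h A B m)
  tfae_have 2 → 1 := fun h m => valuationRing_localization_of_mulMap fun A B =>
    (isGVTorsion_ker_mulMap_iff A B).1 (h A B) m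
  tfae_finish
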